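/- **Setting.** A (locally finite) weighted graph is $G=(V,w,\mu)$ with $\mu:V\to(0,\infty)$, $w:V\times V\to[0,\infty)$, $w_{xy}=w_{yx}$, $w_{xx}=0$, $x\sim y$ iff $w_{xy}\neq0$, each vertex having finitely many neighbours; put $p_{xy}=w_{xy}/\mu_x$. A connection graph $(G,\sigma)$ with $1$-dimensional connections carries numbers $\sigma_{xy}\in H$ for $x\sim y$ with $\sigma_{xy}=\sigma_{yx}^{-1}$, where $H=O(1)=\{\pm1\}$ ($\mathbb K=\mathbb R$) or $H=U(1)$ ($\mathbb K=\mathbb C$). For $f,g:V\to\mathbb K$ let $$\Delta f(x)=\sum_{y\sim x}p_{xy}(f(y)-f(x)),\qquad \Delta^\sigma f(x)=\sum_{y\sim x}p_{xy}(\sigma_{xy}f(y)-f(x)),$$ $$2\Gamma^\sigma(f,g)=\Delta(f\bar g)-f\,\overline{\Delta^\sigma g}-(\Delta^\sigma f)\bar g,\qquad 2\Gamma_2^\sigma(f,g)=\Delta\Gamma^\sigma(f,g)-\Gamma^\sigma(f,\Delta^\sigma g)-\Gamma^\sigma(\Delta^\sigma f,g).$$ For $N\in(0,\infty]$ (with $\frac1\infty=0$),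 $\mathcal K_{G,\sigma,x}(N)$ is the largest $K\in\mathbb R$ such that $\Gamma_2^\sigma(f,f)(x)\ge\frac1N|\Delta^\sigma f(x)|^2+K\,\Gamma^\sigma(f,f)(x)$ for all $f:V\to\mathbb K$. The incomplete $2$-ball $B_2^{inc}(x)$ is the subgraph induced on the vertices at distance at most $2$ from $x$, with the edges between two vertices at distance exactly $2$ removed. The local connection structure at $x$ is balanced if every cycle $x_0\sim x_1\sim\dots\sim x_n\sim x_0$ in $B_2^{inc}(x)$ satisfies $\sigma_{x_0x_1}\sigma_{x_1x_2}\cdots\sigma_{x_nx_0}=1$. For $\alpha,\beta>0$ the Cartesian product $(G\times_{\alpha,\beta}G',\sigma^\times)$ has vertex set $V\times V'$, measure $\mu_{(x,x')}=\mu_x\mu'_{x'}$, weights $w_{(x,x')(y,x')}=\alpha w_{xy}\mu'_{x'}$, $w_{(x,x')(x,y')}=\beta w'_{x'y'}\mu_x$ (all others $0$), and connection $\sigma^\times_{(x,x')(y,x')}=\sigma_{xy}$, $\sigma^\times_{(x,x')(x,y')}=\sigma'_{x'y'}$. If $f_1,f_2:(0,\infty]\to\mathbb R$ are continuous and non-decreasing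 with $\lim_{t\to0}f_i(t)=-\infty$, their star product is $(f_1*f_2)(t)=f_1(t_1)=f_2(t_2)$, where $t_1,t_2\in(0,\infty]$, $t_1+t_2=t$ and $f_1(t_1)=f_2(t_2)$ (such $t_1,t_2$ exist and the value does not depend on their choice). **Statement.** Let $(G,\sigma)$ and $(G',\sigma')$ be two connection graphs with $1$-dimensional connections (over the same $\mathbb K$), let $\alpha,\beta>0$, and let $x\in V$, $x'\in V'$ be vertices each having at least one neighbour. Assume that the local connection structure at $x$ or the one at $x'$ is balanced. Then the maxima defining $\mathcal K_{G,\sigma,x}(N)$, $\mathcal K_{G',\sigma',x'}(N)$ and $\mathcal K_{G\times_{\alpha,\beta}G',\sigma^\times,(x,x')}(N)$ exist for all $N\in(0,\infty]$, and for all $N,N'\in(0,\infty]$ $$\min\{\alpha\mathcal K_{G,\sigma,x}(N),\beta\mathcal K_{G',\sigma',x'}(N')\}\le\mathcal K_{G\times_{\alpha,\beta}G',\sigma^\times,(x,x')}(N+N')\le\max\{\alpha\mathcal K_{G,\sigma,x}(N),\beta\mathcal K_{G',\sigma',x'}(N')\}.$$ Moreover, $\alpha\mathcal K_{G,\sigma,x}$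 and $\beta\mathcal K_{G',\sigma',x'}$ are continuous and non-decreasing on $(0,\infty]$ with limit $-\infty$ at $0$, and on $(0,\infty]$ $$\mathcal K_{G\times_{\alpha,\beta}G',\sigma^\times,(x,x')}=(\alpha\mathcal K_{G,\sigma,x})*(\beta\mathcal K_{G',\sigma',x'}).$$ -/

import Mathlib

open scoped ENNReal Topology

noncomputable section

/-- A locally finite weighted graph `(V, w, μ)`; two vertices are adjacent iff `w x y ≠ 0`. -/
structure WeightedGraph (V : Type*) where
  w : V → V → ℝ
  μ : V → ℝ
  w_nonneg : ∀ x y, 0 ≤ w x y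
  w_symm : ∀ x y, w x y = w y x
  w_self : ∀ x, w x x = 0
  μ_pos : ∀ x, 0 < μ x
  locallyFinite : ∀ x, {y | w x y ≠ 0}.Finite

namespace WeightedGraph

variable {V : Type*} (G : WeightedGraph V)

/-- The underlying simple graph. -/
def graph : SimpleGraph V where
  Adj x y := G.w x y ≠ 0
  symm := ⟨fun x y h => by rw [G.w_symm]; exact h⟩
  loopless := ⟨fun x h => h (G.w_self x)⟩

/-- The (finite) set of neighbours of a vertex. -/
def nbr (x : V) : Finset V := (G.locallyFinite x).toFinset

/-- The transition rate `p_{xy} = w_{xy} / μ_x`. -/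
def p (x y : V) : ℝ := G.w x y / G.μ x

/-- The Laplacian `Δ h (x) = ∑_{y ∼ x} p_{xy} (h y - h x)` on scalar functions. -/
def lap {𝕜 : Type*} [RCLike 𝕜] (h : V → 𝕜) (x : V) : 𝕜 :=
  ∑ y ∈ G.nbr x, (G.p x y : 𝕜) * (h y - h x)

/-- The incomplete 2-ball around `x`: the subgraph induced on the ball of radius two with the edges
inside the 2-sphere removed (vertices outside of the ball are isolated). -/
def incTwoBall (x : V) : SimpleGraph V where
  Adj u v := G.graph.Adj u v ∧ G.graph.edist x u ≤ 2 ∧ G.graph.edist x v ≤ 2 ∧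
    ¬ (G.graph.edist x u = 2 ∧ G.graph.edist x v = 2)
  symm := ⟨fun _ _ h => ⟨h.1.symm, h.2.2.1, h.2.1, fun h' => h.2.2.2 ⟨h'.2, h'.1⟩⟩⟩
  loopless := ⟨fun x h => G.graph.loopless.irrefl x h.1⟩

end WeightedGraph

/-- A connection graph with one-dimensional connections. For `𝕜 = ℝ` the group `unitary 𝕜` is
`O(1) = {±1}`, for `𝕜 = ℂ` it is `U(1)`. Only the values of `σ` on oriented edges matter. -/
structure ConnectionGraph (𝕜 : Type*) [RCLike 𝕜] (V : Type*) extends WeightedGraph V where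
  σ : V → V → unitary 𝕜
  σ_inv : ∀ x y, w x y ≠ 0 → σ x y = (σ y x)⁻¹

namespace ConnectionGraph

variable {𝕜 : Type*} [RCLike 𝕜] {V V' : Type*}

/-- The product of the connections along a walk in some graph on the vertex set. -/
def signature (G : ConnectionGraph 𝕜 V) {H : SimpleGraph V} {u v : V} (c : H.Walk u v) :
    unitary 𝕜 :=
  (c.darts.map fun e => G.σ e.fst e.snd).prod

/-- The local connection structure of the incomplete 2-ball around `x` is balanced: each of its
cycles has trivial signature. -/
def LocallyBalanced (G : ConnectionGraph 𝕜 V) (x : V) : Prop :=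
  ∀ (v : V) (c : (G.incTwoBall x).Walk v v), c.IsCycle → G.signature c = 1

/-- The connection Laplacian. -/
def connLap (G : ConnectionGraph 𝕜 V) (f : V → 𝕜) (x : V) : 𝕜 :=
  ∑ y ∈ G.nbr x, (G.p x y : 𝕜) * ((G.σ x y : 𝕜) * f y - f x)

/-- `2 Γ(f, g) = Δ(f ḡ) - f \bar{Δ^σ g} - (Δ^σ f) ḡ`. -/
def Gam (G : ConnectionGraph 𝕜 V) (f g : V → 𝕜) (x : V) : 𝕜 :=
  (1 / 2 : 𝕜) * (G.lap (fun y => f y * star (g y)) x - f x * star (G.connLap g x)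
    - G.connLap f x * star (g x))

/-- `2 Γ₂(f, g) = Δ Γ(f, g) - Γ(f, Δ^σ g) - Γ(Δ^σ f, g)`. -/
def Gam₂ (G : ConnectionGraph 𝕜 V) (f g : V → 𝕜) (x : V) : 𝕜 :=
  (1 / 2 : 𝕜) * (G.lap (G.Gam f g) x - G.Gam f (G.connLap g) x - G.Gam (G.connLap f) g x)

/-- `Γ` is Hermitian. -/
theorem star_Gam (G : ConnectionGraph 𝕜 V) (f g : V → 𝕜) (x : V) :
    star (G.Gam f g x) = G.Gam g f x := by
  simp only [Gam, WeightedGraph.lap, star_mul', star_sub, star_sum, RCLike.star_def,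
    RCLike.conj_ofReal, RCLike.conj_conj, map_div₀, map_one, map_ofNat, mul_comm (g _)]
  ring

/-- `Γ₂` is Hermitian; in particular `Γ₂(f, f)` is real, as is `Γ(f, f)`. -/
theorem star_Gam₂ (G : ConnectionGraph 𝕜 V) (f g : V → 𝕜) (x : V) :
    star (G.Gam₂ f g x) = G.Gam₂ g f x := by
  simp only [Gam₂, WeightedGraph.lap, star_mul', star_sub, star_sum, star_Gam]
  simp only [RCLike.star_def, RCLike.conj_ofReal, map_div₀, map_one, map_ofNat]
  ring

/-- The curvature dimension inequality `CD^σ(K, N)` at `x`, for `N ∈ (0, ∞]` (with `1 / ∞ = 0`).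
The values `Γ(f, f)` and `Γ₂(f, f)` are real. -/
def CD (G : ConnectionGraph 𝕜 V) (x : V) (K : ℝ) (N : ℝ≥0∞) : Prop :=
  ∀ f : V → 𝕜,
    RCLike.re (G.Gam₂ f f x) ≥
      N⁻¹.toReal * ‖G.connLap f x‖ ^ 2 + K * RCLike.re (G.Gam f f x)

/-- The Bakry-Émery curvature function at `x`, as a function of `N ∈ (0, ∞]`: the largest `K` such
that `CD^σ(K, N)` holds at `x`. -/
def curvature (G : ConnectionGraph 𝕜 V) (x : V) (N : ℝ≥0∞) : ℝ :=
  sSup {K : ℝ | G.CD x K N}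

open Classical in
/-- The weights of the Cartesian product. As `w x x = 0`, at most one summand is nonzero. -/
def prodW (α β : ℝ) (G : ConnectionGraph 𝕜 V) (G' : ConnectionGraph 𝕜 V') (p q : V × V') : ℝ :=
  (if p.2 = q.2 then α * G.w p.1 q.1 * G'.μ p.2 else 0) +
    (if p.1 = q.1 then β * G'.w p.2 q.2 * G.μ p.1 else 0)

open Classical in
/-- The Cartesian product `(G, σ) ×_{α,β} (G', σ')` of two connection graphs. -/
def prod (α β : ℝ) (hα : 0 < α) (hβ : 0 < β) (G : ConnectionGraph 𝕜 V)
    (G' : ConnectionGraph 𝕜 V') : ConnectionGraph 𝕜 (V × V') where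
  w := prodW α β G G'
  μ p := G.μ p.1 * G'.μ p.2
  w_nonneg p q := by
    have h1 := G.w_nonneg p.1 q.1
    have h2 := G'.w_nonneg p.2 q.2
    have h3 := G.μ_pos p.1
    have h4 := G'.μ_pos p.2
    unfold prodW
    split_ifs <;> positivity
  w_symm p q := by
    unfold prodW
    rw [G.w_symm p.1, G'.w_symm p.2]
    congr 1
    · by_cases h : p.2 = q.2
      · simp [h]
      · simp [h, Ne.symm h]
    · by_cases h : p.1 = q.1
      · simp [h]
      · simp [h, Ne.symm h]
  w_self p := by simp [prodW, G.w_self, G'.w_self]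
  μ_pos p := mul_pos (G.μ_pos _) (G'.μ_pos _)
  locallyFinite p := by
    refine Set.Finite.subset
      (((G.locallyFinite p.1).image fun y => (y, p.2)).union
        ((G'.locallyFinite p.2).image fun y' => (p.1, y'))) ?_
    rintro ⟨y, y'⟩ h
    simp only [prodW, Set.mem_ofPred_eq] at h
    by_cases h1 : p.2 = y' ∧ G.w p.1 y ≠ 0
    · exact Or.inl ⟨y, h1.2, by rw [h1.1]⟩
    · by_cases h2 : p.1 = y ∧ G'.w p.2 y' ≠ 0
      · exact Or.inr ⟨y', h2.2, by rw [h2.1]⟩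
      · exfalso
        apply h
        rw [not_and, not_not] at h1 h2
        have e1 : (if p.2 = y' then α * G.w p.1 y * G'.μ p.2 else 0) = 0 := by
          split_ifs with h3
          · simp [h1 h3]
          · rfl
        have e2 : (if p.1 = y then β * G'.w p.2 y' * G.μ p.1 else 0) = 0 := by
          split_ifs with h3
          · simp [h2 h3]
          · rfl
        rw [e1, e2, add_zero]
  σ p q := if p.2 = q.2 then G.σ p.1 q.1 else if p.1 = q.1 then G'.σ p.2 q.2 else 1
  σ_inv p q h := by
    unfold prodW at h
    by_cases h1 : p.2 = q.2
    · have hw : G.w p.1 q.1 ≠ 0 := by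
        intro h0
        apply h
        simp [h1, h0, G'.w_self]
      simpa [h1] using G.σ_inv _ _ hw
    · have h1' : ¬ q.2 = p.2 := fun h' => h1 h'.symm
      by_cases h2 : p.1 = q.1
      · have hw : G'.w p.2 q.2 ≠ 0 := by
          intro h0
          apply h
          simp [h1, h0]
        simpa [h1, h1', h2] using G'.σ_inv _ _ hw
      · exact absurd (by simp [h1, h2]) h

end ConnectionGraph

/-- The functions on `(0, ∞]` of which star products are formed: continuous and monotone increasing
on `(0, ∞]` with limit `-∞` at `0`. The value at `0` plays no role. -/
structure StarAdmissible (f : ℝ≥0∞ → ℝ) : Prop where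
  continuousOn : ContinuousOn f (Set.Ioi 0)
  monotoneOn : MonotoneOn f (Set.Ioi 0)
  tendsto_zero : Filter.Tendsto f (𝓝[>] 0) Filter.atBot

open Classical in
/-- The star product: `(f₁ * f₂)(t) = f₁(t₁) = f₂(t₂)` where `t₁ + t₂ = t` and `f₁(t₁) = f₂(t₂)`. -/
def starProduct (f₁ f₂ : ℝ≥0∞ → ℝ) (t : ℝ≥0∞) : ℝ :=
  if h : ∃ t₁ t₂ : ℝ≥0∞, 0 < t₁ ∧ 0 < t₂ ∧ t₁ + t₂ = t ∧ f₁ t₁ = f₂ t₂ then f₁ h.choose else 0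

/-- The value of the star product does not depend on the chosen decomposition. -/
theorem StarAdmissible.starProduct_eq {f₁ f₂ : ℝ≥0∞ → ℝ} (h₁ : StarAdmissible f₁)
    (h₂ : StarAdmissible f₂) {t₁ t₂ : ℝ≥0∞} (ht₁ : 0 < t₁) (ht₂ : 0 < t₂) (h : f₁ t₁ = f₂ t₂) :
    starProduct f₁ f₂ (t₁ + t₂) = f₁ t₁ := by
  have key : ∀ t₁ t₂ s₁ s₂ : ℝ≥0∞, 0 < t₁ → 0 < t₂ → 0 < s₁ → 0 < s₂ → t₁ + t₂ = s₁ + s₂ →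
      f₁ t₁ = f₂ t₂ → f₁ s₁ = f₂ s₂ → t₁ ≤ s₁ → f₁ t₁ = f₁ s₁ := by
    intro t₁ t₂ s₁ s₂ ht₁ ht₂ hs₁ hs₂ hsum ht hs hle
    by_cases h' : s₂ ≤ t₂
    · have e1 := h₁.monotoneOn (Set.mem_Ioi.2 ht₁) (Set.mem_Ioi.2 hs₁) hle
      have e2 := h₂.monotoneOn (Set.mem_Ioi.2 hs₂) (Set.mem_Ioi.2 ht₂) h'
      linarith
    · rw [not_le] at h'
      by_cases hT : t₁ = ∞
      · rw [hT] at hle ⊢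
        rw [top_le_iff.1 hle]
      · exact absurd hsum (ENNReal.add_lt_add_of_le_of_lt hT hle h').ne
  have hex : ∃ s₁ s₂ : ℝ≥0∞, 0 < s₁ ∧ 0 < s₂ ∧ s₁ + s₂ = t₁ + t₂ ∧ f₁ s₁ = f₂ s₂ :=
    ⟨t₁, t₂, ht₁, ht₂, rfl, h⟩
  unfold starProduct
  rw [dif_pos hex]
  obtain ⟨s₂, hs₁, hs₂, hs, hfs⟩ := hex.choose_spec
  rcases le_total hex.choose t₁ with hle | hle
  · exact key _ _ _ _ hs₁ hs₂ ht₁ ht₂ hs hfs h hle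
  · exact (key _ _ _ _ ht₁ ht₂ hs₁ hs₂ hs.symm h hfs hle).symm

/-- The decomposition that defines the star product exists. -/
theorem StarAdmissible.exists_decomposition {f₁ f₂ : ℝ≥0∞ → ℝ} (h₁ : StarAdmissible f₁)
    (h₂ : StarAdmissible f₂) {t : ℝ≥0∞} (ht : 0 < t) :
    ∃ t₁ t₂ : ℝ≥0∞, 0 < t₁ ∧ 0 < t₂ ∧ t₁ + t₂ = t ∧ f₁ t₁ = f₂ t₂ := by
  have finite_case : ∀ t : ℝ≥0∞, 0 < t → t ≠ ∞ →
      ∃ t₁ t₂ : ℝ≥0∞, 0 < t₁ ∧ 0 < t₂ ∧ t₁ + t₂ = t ∧ f₁ t₁ = f₂ t₂ := by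
    intro t ht hT
    have hsub : Filter.Tendsto (fun s => t - s) (𝓝[>] 0) (𝓝 t) := by
      have := (ENNReal.continuous_sub_left hT).tendsto 0
      rw [tsub_zero] at this
      exact this.mono_left nhdsWithin_le_nhds
    -- a small point `s` with `f s < g (t - s)`
    have small : ∀ f g : ℝ≥0∞ → ℝ, StarAdmissible f → StarAdmissible g →
        ∃ s, 0 < s ∧ s < t ∧ f s < g (t - s) := by
      intro f g hf hg
      obtain ⟨r, hr0, hrt⟩ := exists_between ht
      have ev1 : ∀ᶠ s in 𝓝[>] (0 : ℝ≥0∞), r < t - s := hsub.eventually (lt_mem_nhds hrt)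
      have ev2 := hf.tendsto_zero.eventually (Filter.eventually_lt_atBot (g r))
      have ev3 : ∀ᶠ s in 𝓝[>] (0 : ℝ≥0∞), s < t := nhdsWithin_le_nhds (gt_mem_nhds ht)
      have ev4 : ∀ᶠ s in 𝓝[>] (0 : ℝ≥0∞), s ∈ Set.Ioi 0 := self_mem_nhdsWithin
      obtain ⟨s, hs1, hs2, hs3, hs4⟩ := (ev1.and (ev2.and (ev3.and ev4))).exists
      exact ⟨s, hs4, hs3, hs2.trans_le
        (hg.monotoneOn (Set.mem_Ioi.2 hr0) (Set.mem_Ioi.2 (hr0.trans hs1)) hs1.le)⟩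
    obtain ⟨a, ha0, hat, ha⟩ := small f₁ f₂ h₁ h₂
    obtain ⟨b, hb0, hbt, hb⟩ := small f₂ f₁ h₂ h₁
    have hbT : t - (t - b) = b := ENNReal.sub_sub_cancel hT hbt.le
    have cont2 : ContinuousOn (fun s => f₂ (t - s)) (Set.Ioo 0 t) :=
      h₂.continuousOn.comp (ENNReal.continuous_sub_left hT).continuousOn
        fun s hs => Set.mem_Ioi.2 (tsub_pos_of_lt hs.2)
    have cont1 : ContinuousOn f₁ (Set.Ioo 0 t) :=
      h₁.continuousOn.mono fun s hs => Set.mem_Ioi.2 hs.1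
    obtain ⟨c, hc, hfc⟩ := isPreconnected_Ioo.intermediate_value₂
      (show a ∈ Set.Ioo 0 t from ⟨ha0, hat⟩)
      (show t - b ∈ Set.Ioo 0 t from ⟨tsub_pos_of_lt hbt, ENNReal.sub_lt_self hT ht.ne' hb0.ne'⟩)
      cont1 cont2 ha.le (by rw [hbT]; exact hb.le)
    exact ⟨c, t - c, hc.1, tsub_pos_of_lt hc.2, add_tsub_cancel_of_le hc.2.le, hfc⟩
  by_cases hT : t = ∞
  · subst hT
    -- the function with the larger value at infinity attains the other value
    have inf_case : ∀ f g : ℝ≥0∞ → ℝ, StarAdmissible f → StarAdmissible g → f ∞ ≤ g ∞ →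
        ∃ s, 0 < s ∧ g s = f ∞ := by
      intro f g hf hg hle
      have ev1 := hg.tendsto_zero.eventually (Filter.eventually_lt_atBot (f ∞))
      have ev2 : ∀ᶠ s in 𝓝[>] (0 : ℝ≥0∞), s ∈ Set.Ioi 0 := self_mem_nhdsWithin
      obtain ⟨s, hs1, hs2⟩ := (ev1.and ev2).exists
      obtain ⟨c, hc, hfc⟩ := isPreconnected_Ioi.intermediate_value₂ hs2
        (show (∞ : ℝ≥0∞) ∈ Set.Ioi 0 from ENNReal.zero_lt_top) hg.continuousOn
        continuousOn_const hs1.le hle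
      exact ⟨c, hc, hfc⟩
    rcases le_total (f₁ ∞) (f₂ ∞) with hle | hle
    · obtain ⟨s, hs, he⟩ := inf_case f₁ f₂ h₁ h₂ hle
      exact ⟨∞, s, ENNReal.zero_lt_top, hs, top_add s, he.symm⟩
    · obtain ⟨s, hs, he⟩ := inf_case f₂ f₁ h₂ h₁ hle
      exact ⟨s, ∞, hs, ENNReal.zero_lt_top, add_top s, he⟩
  · exact finite_case t ht hT

end

namespace WeightedGraph

variable {V : Type*} (G : WeightedGraph V)

/-! Everything at a vertex is expressed through the covariant differences σ_{uv} f(v) - f(u): `Gam`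
is half the weighted sum of their products, so Γ(f, f) ≥ 0, and Cauchy-Schwarz gives |Δ^σ f|² ≤ 2
deg(x) Γ(f, f). With a bound Γ₂ ≥ C Γ this makes the curvature a maximum and Lipschitz in 1/N;
continuity, monotonicity and the limit at 0 follow.

On the product, Γ₂ equals α²Γ₂ + β²Γ₂' plus two sums of squared mixed differences (`prod_Gam₂`).
Dropping these nonnegative sums and using |a + b|²/(N + N') ≤ |a|²/N + |b|²/N' gives the lower
bound.

For the upper bound, suppose the product curvature exceeds both scaled factor curvatures at N and
N'. Then each factor has a function violating the corresponding inequality. Two functions that agree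
at the base point are glued into one on the product with vanishing mixed differences
(`exists_extension`). Agreement costs nothing when one side is balanced: a multiple of a local
parallel section shifts the base value and leaves all differences unchanged
(`LocallyBalanced.exists_translate`). Scaling to αΔ^σ f = N, βΔ^σ' f' = N' turns the Cauchy-Schwarz
step into an equality, and adding the two violations gives a contradiction.

At t = t₁ + t₂ with equal factor values, minimum and maximum coincide, which is the star product
formula. -/

theorem mem_nbr {x y : V} : y ∈ G.nbr x ↔ G.graph.Adj x y := by
  simp [nbr, graph]

theorem p_nonneg (x y : V) : 0 ≤ G.p x y := div_nonneg (G.w_nonneg x y) (G.μ_pos x).le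

theorem p_pos {x y : V} (h : G.graph.Adj x y) : 0 < G.p x y :=
  div_pos ((G.w_nonneg x y).lt_of_ne (Ne.symm h)) (G.μ_pos x)

/-- The weighted degree `∑_{y ∼ x} p_{xy}`. -/
noncomputable def deg (x : V) : ℝ := ∑ y ∈ G.nbr x, G.p x y

theorem deg_nonneg (x : V) : 0 ≤ G.deg x := Finset.sum_nonneg fun y _ => G.p_nonneg x y

end WeightedGraph

/-! ### Covariant differences and bounds for Γ and Γ₂ -/

namespace ConnectionGraph

variable {𝕜 : Type*} [RCLike 𝕜] {V V' : Type*} (G : ConnectionGraph 𝕜 V)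

/-- The covariant difference `σ_{uv} f(v) - f(u)`. -/
def grad (f : V → 𝕜) (u v : V) : 𝕜 := (G.σ u v : 𝕜) * f v - f u

theorem connLap_eq_sum_grad (f : V → 𝕜) (x : V) :
    G.connLap f x = ∑ y ∈ G.nbr x, (G.p x y : 𝕜) * G.grad f x y := rfl

theorem Gam_eq_sum_grad (f g : V → 𝕜) (x : V) :
    G.Gam f g x =
      (1 / 2 : 𝕜) * ∑ y ∈ G.nbr x, (G.p x y : 𝕜) * (G.grad f x y * star (G.grad g x y)) := by
  unfold Gam WeightedGraph.lap
  rw [connLap_eq_sum_grad, connLap_eq_sum_grad, star_sum, Finset.mul_sum, Finset.sum_mul,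
    ← Finset.sum_sub_distrib, ← Finset.sum_sub_distrib]
  congr 1
  refine Finset.sum_congr rfl fun y _ => ?_
  have hσ : (G.σ x y : 𝕜) * star (G.σ x y : 𝕜) = 1 := Unitary.coe_mul_star_self _
  simp only [grad, star_mul', star_sub, RCLike.star_def, RCLike.conj_ofReal] at hσ ⊢
  linear_combination -((G.p x y : 𝕜) * f y * (starRingEnd 𝕜) (g y)) * hσ

theorem re_Gam_self (f : V → 𝕜) (x : V) :
    RCLike.re (G.Gam f f x) = 1 / 2 * ∑ y ∈ G.nbr x, G.p x y * ‖G.grad f x y‖ ^ 2 := by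
  have : G.Gam f f x = ((1 / 2 * ∑ y ∈ G.nbr x, G.p x y * ‖G.grad f x y‖ ^ 2 : ℝ) : 𝕜) := by
    rw [Gam_eq_sum_grad]
    push_cast
    simp only [RCLike.star_def, RCLike.mul_conj]
  rw [this, RCLike.ofReal_re]

theorem re_Gam_self_nonneg (f : V → 𝕜) (x : V) : 0 ≤ RCLike.re (G.Gam f f x) := by
  rw [re_Gam_self]
  have := fun y => G.p_nonneg x y
  exact mul_nonneg (by norm_num)
    (Finset.sum_nonneg fun y _ => mul_nonneg (this y) (sq_nonneg _))

theorem norm_connLap_sq_le (f : V → 𝕜) (x : V) :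
    ‖G.connLap f x‖ ^ 2 ≤ 2 * G.deg x * RCLike.re (G.Gam f f x) := by
  have h1 : ‖G.connLap f x‖ ≤ ∑ y ∈ G.nbr x, G.p x y * ‖G.grad f x y‖ := by
    rw [connLap_eq_sum_grad]
    refine (norm_sum_le _ _).trans (Finset.sum_le_sum fun y _ => ?_)
    rw [norm_mul, RCLike.norm_ofReal, abs_of_nonneg (G.p_nonneg x y)]
  have h2 : (∑ y ∈ G.nbr x, G.p x y * ‖G.grad f x y‖) ^ 2 ≤
      (∑ y ∈ G.nbr x, G.p x y) * ∑ y ∈ G.nbr x, G.p x y * ‖G.grad f x y‖ ^ 2 :=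
    Finset.sum_sq_le_sum_mul_sum_of_sq_le_mul _ (fun y _ => G.p_nonneg x y)
      (fun y _ => mul_nonneg (G.p_nonneg x y) (sq_nonneg _)) (fun y _ => (by ring : _ = _).le)
  rw [re_Gam_self, WeightedGraph.deg]
  calc ‖G.connLap f x‖ ^ 2 ≤ _ := pow_le_pow_left₀ (norm_nonneg _) h1 2
    _ ≤ _ := h2
    _ = _ := by ring

theorem grad_connLap (f : V → 𝕜) (x y : V) :
    G.grad (G.connLap f) x y = (G.σ x y : 𝕜) * G.connLap f y - G.connLap f x := rfl

theorem re_lap (h : V → 𝕜) (x : V) :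
    RCLike.re (G.lap h x) = ∑ y ∈ G.nbr x, G.p x y * (RCLike.re (h y) - RCLike.re (h x)) := by
  unfold WeightedGraph.lap
  simp only [map_sum, RCLike.re_ofReal_mul, map_sub]

theorem re_Gam₂_self (f : V → 𝕜) (x : V) :
    2 * RCLike.re (G.Gam₂ f f x) =
      (∑ y ∈ G.nbr x, G.p x y * (RCLike.re (G.Gam f f y) - RCLike.re (G.Gam f f x))) -
        2 * RCLike.re (G.Gam f (G.connLap f) x) := by
  have h1 : RCLike.re (G.Gam (G.connLap f) f x) = RCLike.re (G.Gam f (G.connLap f) x) := by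
    rw [← G.star_Gam f, RCLike.star_def, RCLike.conj_re]
  have h2 : (2 : ℝ) * RCLike.re (G.Gam₂ f f x) = RCLike.re ((2 : 𝕜) * G.Gam₂ f f x) := by
    have := RCLike.re_ofReal_mul (K := 𝕜) 2 (G.Gam₂ f f x)
    rw [← this]; norm_num
  rw [h2, Gam₂, ← mul_assoc, mul_one_div_cancel two_ne_zero, one_mul, map_sub, map_sub, re_lap, h1]
  ring

/-- The operators at `x` only depend on covariant differences along edges meeting the closed
1-ball around `x`. -/
theorem connLap_congr {f g : V → 𝕜} {x : V} (h : ∀ v ∈ G.nbr x, G.grad f x v = G.grad g x v) :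
    G.connLap f x = G.connLap g x := by
  rw [connLap_eq_sum_grad, connLap_eq_sum_grad]
  exact Finset.sum_congr rfl fun y hy => by rw [h y hy]

theorem Gam_congr {f g f' g' : V → 𝕜} {x : V} (h : ∀ v ∈ G.nbr x, G.grad f x v = G.grad g x v)
    (h' : ∀ v ∈ G.nbr x, G.grad f' x v = G.grad g' x v) :
    G.Gam f f' x = G.Gam g g' x := by
  rw [Gam_eq_sum_grad, Gam_eq_sum_grad]
  congr 1
  exact Finset.sum_congr rfl fun y hy => by rw [h y hy, h' y hy]

/-- Only edges issuing from x or from a neighbour of x enter Γ₂ at x; edges inside the 2-sphere do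
not. This is why balancedness is only needed on the incomplete 2-ball. -/
theorem Gam₂_congr {f g : V → 𝕜} {x : V} (h : ∀ v ∈ G.nbr x, G.grad f x v = G.grad g x v)
    (h' : ∀ u ∈ G.nbr x, ∀ v ∈ G.nbr u, G.grad f u v = G.grad g u v) :
    G.Gam₂ f f x = G.Gam₂ g g x := by
  have hL : ∀ v ∈ G.nbr x, G.grad (G.connLap f) x v = G.grad (G.connLap g) x v := fun v hv => by
    rw [grad_connLap, grad_connLap, G.connLap_congr h, G.connLap_congr (h' v hv)]
  unfold Gam₂
  rw [G.Gam_congr h hL, G.Gam_congr hL h]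
  congr 3
  exact Finset.sum_congr rfl fun y hy => by rw [G.Gam_congr h h, G.Gam_congr (h' y hy) (h' y hy)]

theorem norm_unitary (u : unitary 𝕜) : ‖(u : 𝕜)‖ = 1 := CStarRing.norm_coe_unitary u

/-- In 2Γ₂(f, f)(x) the only term without an evident lower bound is the pairing of the differences
at x with Δ^σ f(y). By AM-GM it is at most Γ(f, f)(y) plus a multiple of the squared difference
along xy; the Γ(f, f)(y) cancel against those from ΔΓ, and the rest is a multiple of Γ(f, f)(x). -/
theorem exists_le_Gam₂ (x : V) :
    ∃ C : ℝ, ∀ f : V → 𝕜, C * RCLike.re (G.Gam f f x) ≤ RCLike.re (G.Gam₂ f f x) := by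
  obtain ⟨M, hdM⟩ : ∃ M, ∀ y ∈ G.nbr x, G.deg y ≤ M := ⟨∑ y ∈ G.nbr x, G.deg y, fun y hy =>
    Finset.single_le_sum (f := fun y => G.deg y) (fun y _ => G.deg_nonneg y) hy⟩
  refine ⟨-(G.deg x + M) / 2, fun f => ?_⟩
  have key := G.re_Gam₂_self f x
  have e1 : 2 * RCLike.re (G.Gam f (G.connLap f) x) =
      (∑ y ∈ G.nbr x, G.p x y * RCLike.re (G.grad f x y * star ((G.σ x y : 𝕜) * G.connLap f y)))
        - ‖G.connLap f x‖ ^ 2 := by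
    have e2 : (‖G.connLap f x‖ ^ 2 : ℝ) =
        RCLike.re (∑ y ∈ G.nbr x, (G.p x y : 𝕜) * (G.grad f x y * star (G.connLap f x))) := by
      simp only [← mul_assoc]
      rw [← Finset.sum_mul, ← connLap_eq_sum_grad, RCLike.star_def, RCLike.mul_conj]
      norm_cast
    have e3 : 2 * RCLike.re (G.Gam f (G.connLap f) x) =
        RCLike.re ((2 : 𝕜) * G.Gam f (G.connLap f) x) := by
      rw [← RCLike.re_ofReal_mul]; norm_num
    rw [e2, e3, Gam_eq_sum_grad, ← mul_assoc, mul_one_div_cancel two_ne_zero, one_mul]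
    simp only [grad_connLap, star_sub, mul_sub, Finset.sum_sub_distrib, map_sub]
    simp only [map_sum, RCLike.re_ofReal_mul]
  have e4 : ∀ y ∈ G.nbr x,
      G.p x y * RCLike.re (G.grad f x y * star ((G.σ x y : 𝕜) * G.connLap f y)) ≤
        G.p x y * (RCLike.re (G.Gam f f y) + 1 / 2 * M * ‖G.grad f x y‖ ^ 2) := by
    intro y hy
    refine mul_le_mul_of_nonneg_left ?_ (G.p_nonneg x y)
    refine (RCLike.re_le_norm _).trans ?_
    rw [norm_mul, norm_star, norm_mul, norm_unitary, one_mul]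
    have hb : ‖G.connLap f y‖ ≤ ∑ z ∈ G.nbr y, G.p y z * ‖G.grad f y z‖ := by
      rw [connLap_eq_sum_grad]
      refine (norm_sum_le _ _).trans (Finset.sum_le_sum fun z _ => ?_)
      rw [norm_mul, RCLike.norm_ofReal, abs_of_nonneg (G.p_nonneg y z)]
    have hc : ‖G.grad f x y‖ * ∑ z ∈ G.nbr y, G.p y z * ‖G.grad f y z‖ ≤
        RCLike.re (G.Gam f f y) + 1 / 2 * G.deg y * ‖G.grad f x y‖ ^ 2 := by
      rw [re_Gam_self, WeightedGraph.deg, Finset.mul_sum, Finset.mul_sum, Finset.mul_sum,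
        Finset.sum_mul, ← Finset.sum_add_distrib]
      refine Finset.sum_le_sum fun z _ => ?_
      nlinarith [mul_nonneg (G.p_nonneg y z) (sq_nonneg (‖G.grad f x y‖ - ‖G.grad f y z‖))]
    nlinarith [mul_le_mul_of_nonneg_left hb (norm_nonneg (G.grad f x y)),
      mul_le_mul_of_nonneg_right (hdM y hy) (sq_nonneg ‖G.grad f x y‖)]
  have e5 := Finset.sum_le_sum e4
  have e6 : ∑ y ∈ G.nbr x, G.p x y * (RCLike.re (G.Gam f f y) + 1 / 2 * M * ‖G.grad f x y‖ ^ 2) =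
      ∑ y ∈ G.nbr x, G.p x y * RCLike.re (G.Gam f f y) + M * RCLike.re (G.Gam f f x) := by
    rw [re_Gam_self G f x, Finset.mul_sum, Finset.mul_sum, ← Finset.sum_add_distrib]
    exact Finset.sum_congr rfl fun y _ => by ring
  have e7 : ∑ y ∈ G.nbr x, G.p x y * (RCLike.re (G.Gam f f y) - RCLike.re (G.Gam f f x)) =
      ∑ y ∈ G.nbr x, G.p x y * RCLike.re (G.Gam f f y) - G.deg x * RCLike.re (G.Gam f f x) := by
    rw [WeightedGraph.deg, Finset.sum_mul, ← Finset.sum_sub_distrib]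
    exact Finset.sum_congr rfl fun y _ => by ring
  nlinarith [sq_nonneg ‖G.connLap f x‖]

/-- At a vertex with a neighbour the connection Laplacian does not vanish identically. -/
theorem exists_connLap_ne_zero {x : V} (hx : ∃ y, G.graph.Adj x y) :
    ∃ f : V → 𝕜, G.connLap f x ≠ 0 := by
  classical
  obtain ⟨y, hy⟩ := hx
  -- At x only the edge xy contributes, with value p_{xy} σ_{xy}.
  refine ⟨Pi.single y 1, ?_⟩
  have hxy : x ≠ y := hy.ne
  rw [connLap_eq_sum_grad, Finset.sum_eq_single y]
  · have h1 : (G.p x y : 𝕜) ≠ 0 := by exact_mod_cast (G.p_pos hy).ne'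
    have h2 : (G.σ x y : 𝕜) ≠ 0 := norm_ne_zero_iff.1 (by rw [norm_unitary]; exact one_ne_zero)
    simp [grad, hxy, h1, h2]
  · intro z _ hz
    simp [grad, hxy, hz]
  · intro h
    exact absurd (G.mem_nbr.2 hy) h

theorem re_Gam_pos_of_connLap_ne_zero {f : V → 𝕜} {x : V} (h : G.connLap f x ≠ 0) :
    0 < RCLike.re (G.Gam f f x) := by
  refine (G.re_Gam_self_nonneg f x).lt_of_ne fun h0 => h ?_
  have := G.norm_connLap_sq_le f x
  rw [← h0, mul_zero] at this
  exact norm_eq_zero.1 (pow_eq_zero_iff two_ne_zero |>.1 (le_antisymm this (sq_nonneg _)))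

/-! ### The curvature function of a single graph -/

theorem CD.anti {G : ConnectionGraph 𝕜 V} {x : V} {K K' : ℝ} {N : ℝ≥0∞} (h : G.CD x K N)
    (hK : K' ≤ K) : G.CD x K' N := fun f => by
  have h1 := h f
  have h2 := mul_le_mul_of_nonneg_right hK (G.re_Gam_self_nonneg f x)
  linarith

/-- Quantitative dependence of the curvature-dimension inequality on the dimension. -/
theorem CD.shift {G : ConnectionGraph 𝕜 V} {x : V} {K : ℝ} {N N' : ℝ≥0∞} (h : G.CD x K N) :
    G.CD x (K - 2 * G.deg x * |N'⁻¹.toReal - N⁻¹.toReal|) N' := fun f => by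
  have h1 := h f
  have h2 := G.norm_connLap_sq_le f x
  have h3 : (N'⁻¹.toReal - N⁻¹.toReal) * ‖G.connLap f x‖ ^ 2 ≤
      |N'⁻¹.toReal - N⁻¹.toReal| * (2 * G.deg x * RCLike.re (G.Gam f f x)) :=
    (mul_le_mul_of_nonneg_right (le_abs_self _) (sq_nonneg _)).trans
      (mul_le_mul_of_nonneg_left h2 (abs_nonneg _))
  nlinarith

/-- The admissible K form a nonempty set, bounded above by testing one function with Γ > 0, and
closed as an intersection of closed conditions. At N = 0 the convention `0⁻¹.toReal = 0` makes the
condition that of N = ∞. -/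
theorem isGreatest_curvature {x : V} (hx : ∃ y, G.graph.Adj x y) (N : ℝ≥0∞) :
    IsGreatest {K : ℝ | G.CD x K N} (G.curvature x N) := by
  have hne : {K : ℝ | G.CD x K N}.Nonempty := by
    obtain ⟨C, hC⟩ := G.exists_le_Gam₂ x
    -- At N = ∞ there is no dimension term; `CD.shift` then moves to arbitrary N.
    have : G.CD x C ∞ := fun f => by
      have := hC f
      simpa using this
    exact ⟨_, this.shift⟩
  have hbdd : BddAbove {K : ℝ | G.CD x K N} := by
    obtain ⟨f, hf⟩ := G.exists_connLap_ne_zero hx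
    have hpos := G.re_Gam_pos_of_connLap_ne_zero hf
    refine ⟨RCLike.re (G.Gam₂ f f x) / RCLike.re (G.Gam f f x), fun K hK => ?_⟩
    rw [le_div_iff₀ hpos]
    have h1 := hK f
    have h2 : 0 ≤ N⁻¹.toReal * ‖G.connLap f x‖ ^ 2 :=
      mul_nonneg ENNReal.toReal_nonneg (sq_nonneg _)
    linarith
  have hcl : IsClosed {K : ℝ | G.CD x K N} := by
    have : {K : ℝ | G.CD x K N} = ⋂ f : V → 𝕜, {K : ℝ |
        N⁻¹.toReal * ‖G.connLap f x‖ ^ 2 + K * RCLike.re (G.Gam f f x) ≤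
          RCLike.re (G.Gam₂ f f x)} := by
      ext K
      simp only [Set.mem_iInter]
      rfl
    rw [this]
    exact isClosed_iInter fun f => isClosed_le (by fun_prop) continuous_const
  exact ⟨hcl.csSup_mem hne hbdd, fun K hK => le_csSup hbdd hK⟩

theorem CD_iff_le_curvature {x : V} (hx : ∃ y, G.graph.Adj x y) {K : ℝ} {N : ℝ≥0∞} :
    G.CD x K N ↔ K ≤ G.curvature x N :=
  ⟨fun h => (G.isGreatest_curvature hx N).2 h, fun h => CD.anti (G.isGreatest_curvature hx N).1 h⟩

/-- Shifting the optimal inequality from N to N' and back makes the curvature Lipschitz in 1/N,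
which yields continuity up to and including N = ∞. -/
theorem abs_curvature_sub_le {x : V} (hx : ∃ y, G.graph.Adj x y) (N N' : ℝ≥0∞) :
    |G.curvature x N' - G.curvature x N| ≤ 2 * G.deg x * |N'⁻¹.toReal - N⁻¹.toReal| := by
  have h1 := (G.CD_iff_le_curvature hx).1
    (CD.shift (N' := N') (G.isGreatest_curvature hx N).1)
  have h2 := (G.CD_iff_le_curvature hx).1
    (CD.shift (N' := N) (G.isGreatest_curvature hx N').1)
  rw [abs_sub_comm] at h2
  rw [abs_le]
  constructor <;> linarith

theorem starAdmissible_curvature {x : V} (hx : ∃ y, G.graph.Adj x y) :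
    StarAdmissible (G.curvature x) where
  continuousOn := by
    intro N hN
    refine ContinuousAt.continuousWithinAt ?_
    have hinv : Filter.Tendsto (fun N' : ℝ≥0∞ => N'⁻¹.toReal) (𝓝 N) (𝓝 N⁻¹.toReal) :=
      (ENNReal.tendsto_toReal (ENNReal.inv_ne_top.2 (ne_of_gt hN))).comp
        (continuous_inv.tendsto N)
    have hlim : Filter.Tendsto
        (fun N' : ℝ≥0∞ => 2 * G.deg x * |N'⁻¹.toReal - N⁻¹.toReal|) (𝓝 N) (𝓝 0) := by
      have := ((hinv.sub_const N⁻¹.toReal).abs).const_mul (2 * G.deg x)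
      simpa using this
    rw [ContinuousAt, tendsto_iff_dist_tendsto_zero]
    exact squeeze_zero (fun _ => dist_nonneg)
      (fun N' => by rw [Real.dist_eq]; exact G.abs_curvature_sub_le hx N N') hlim
  monotoneOn := by
    intro N hN N' _ hle
    refine (G.CD_iff_le_curvature hx).1 fun f => ?_
    have h1 := (G.isGreatest_curvature hx N).1 f
    have h2 : N'⁻¹.toReal ≤ N⁻¹.toReal :=
      ENNReal.toReal_mono (ENNReal.inv_ne_top.2 (ne_of_gt hN)) (ENNReal.inv_le_inv.2 hle)
    have h3 := mul_le_mul_of_nonneg_right h2 (sq_nonneg ‖G.connLap f x‖)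
    linarith
  tendsto_zero := by
    obtain ⟨f, hf⟩ := G.exists_connLap_ne_zero hx
    have hpos := G.re_Gam_pos_of_connLap_ne_zero hf
    have hL : 0 < ‖G.connLap f x‖ ^ 2 := pow_pos (norm_pos_iff.2 hf) 2
    have hinv : Filter.Tendsto (fun N : ℝ≥0∞ => N⁻¹.toReal) (𝓝[>] 0) Filter.atTop := by
      rw [Filter.tendsto_atTop]
      intro b
      have h1 : Filter.Tendsto (fun N : ℝ≥0∞ => N⁻¹) (𝓝[>] 0) (𝓝 ∞) := by
        have := (continuous_inv (G := ℝ≥0∞)).tendsto 0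
        rw [ENNReal.inv_zero] at this
        exact this.mono_left nhdsWithin_le_nhds
      filter_upwards [h1.eventually (lt_mem_nhds (ENNReal.ofReal_lt_top (r := b))),
        self_mem_nhdsWithin] with N hN hN0
      exact (ENNReal.ofReal_le_iff_le_toReal (ENNReal.inv_ne_top.2 (ne_of_gt hN0))).1 hN.le
    -- A single f with Δ^σ f(x) ≠ 0 bounds the curvature above by (Γ₂ - |Δ^σ f|²/N)/Γ, which tends
    -- to -∞.
    have hlim : Filter.Tendsto (fun N : ℝ≥0∞ =>
        (RCLike.re (G.Gam₂ f f x) + -(N⁻¹.toReal * ‖G.connLap f x‖ ^ 2)) /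
          RCLike.re (G.Gam f f x)) (𝓝[>] 0) Filter.atBot :=
      (Filter.tendsto_atBot_add_const_left _ _ (Filter.tendsto_neg_atTop_atBot.comp
        (hinv.atTop_mul_const hL))).atBot_div_const hpos
    refine Filter.tendsto_atBot_mono (fun N => ?_) hlim
    rw [le_div_iff₀ hpos]
    have := (G.isGreatest_curvature hx N).1 f
    linarith

end ConnectionGraph

theorem StarAdmissible.const_mul {f : ℝ≥0∞ → ℝ} (hf : StarAdmissible f) {c : ℝ} (hc : 0 < c) :
    StarAdmissible fun N => c * f N where
  continuousOn := continuousOn_const.mul hf.continuousOn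
  monotoneOn := fun _ ha _ hb h => mul_le_mul_of_nonneg_left (hf.monotoneOn ha hb h) hc.le
  tendsto_zero := hf.tendsto_zero.const_mul_atBot hc
-- Γ and Γ₂ on the Cartesian product
namespace ConnectionGraph

variable {𝕜 : Type*} [RCLike 𝕜] {V V' : Type*} (G : ConnectionGraph 𝕜 V)
  (G' : ConnectionGraph 𝕜 V') {α β : ℝ} (hα : 0 < α) (hβ : 0 < β)

theorem prod_p_left (u v : V) (u' : V') :
    (prod α β hα hβ G G').p (u, u') (v, u') = α * G.p u v := by
  have h1 := (G.μ_pos u).ne'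
  have h2 := (G'.μ_pos u').ne'
  simp only [WeightedGraph.p, prod, prodW, G'.w_self]
  simp
  field_simp

theorem prod_p_right (u : V) (u' v' : V') :
    (prod α β hα hβ G G').p (u, u') (u, v') = β * G'.p u' v' := by
  have h1 := (G.μ_pos u).ne'
  have h2 := (G'.μ_pos u').ne'
  simp only [WeightedGraph.p, prod, prodW, G.w_self]
  simp
  field_simp

theorem prod_adj_iff (q r : V × V') : (prod α β hα hβ G G').graph.Adj q r ↔
    (q.2 = r.2 ∧ G.graph.Adj q.1 r.1) ∨ (q.1 = r.1 ∧ G'.graph.Adj q.2 r.2) := by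
  obtain ⟨u, u'⟩ := q
  obtain ⟨v, v'⟩ := r
  have h1 := (G.μ_pos u).ne'
  have h2 := (G'.μ_pos u').ne'
  simp only [WeightedGraph.graph, prod, prodW]
  by_cases h : u' = v'
  · subst h
    simp [G'.w_self, hα.ne', h2]
  · by_cases h' : u = v
    · subst h'
      simp [h, hβ.ne', h1]
    · simp [h, h']

/-- The neighbours of (u, u') split into a horizontal and a vertical part, disjoint since there are
no loops. All splitting formulas for the product operators rest on this. -/
theorem sum_nbr_prod (φ : V × V' → 𝕜) (u : V) (u' : V') :
    ∑ q ∈ (prod α β hα hβ G G').nbr (u, u'), ((prod α β hα hβ G G').p (u, u') q : 𝕜) * φ q =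
      α * ∑ y ∈ G.nbr u, (G.p u y : 𝕜) * φ (y, u') +
        β * ∑ y' ∈ G'.nbr u', (G'.p u' y' : 𝕜) * φ (u, y') := by
  classical
  have hn : (prod α β hα hβ G G').nbr (u, u') =
      (G.nbr u).image (fun y => (y, u')) ∪ (G'.nbr u').image (fun y' => (u, y')) := by
    ext ⟨v, v'⟩
    rw [WeightedGraph.mem_nbr, prod_adj_iff]
    simp only [Finset.mem_union, Finset.mem_image, WeightedGraph.mem_nbr, Prod.mk.injEq]
    constructor
    · rintro (⟨rfl, h⟩ | ⟨rfl, h⟩)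
      · exact Or.inl ⟨v, h, rfl, rfl⟩
      · exact Or.inr ⟨v', h, rfl, rfl⟩
    · rintro (⟨_, h, rfl, rfl⟩ | ⟨_, h, rfl, rfl⟩)
      · exact Or.inl ⟨rfl, h⟩
      · exact Or.inr ⟨rfl, h⟩
  have hd : Disjoint ((G.nbr u).image (fun y => (y, u')))
      ((G'.nbr u').image (fun y' => (u, y'))) := by
    rw [Finset.disjoint_left]
    rintro ⟨v, v'⟩ h1 h2
    simp only [Finset.mem_image, WeightedGraph.mem_nbr, Prod.mk.injEq] at h1 h2
    obtain ⟨_, h1, rfl, rfl⟩ := h1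
    obtain ⟨_, h2, rfl, rfl⟩ := h2
    exact h1.ne rfl
  rw [hn, Finset.sum_union hd, Finset.sum_image (fun _ _ _ _ h => (Prod.mk.inj h).1),
    Finset.sum_image (fun _ _ _ _ h => (Prod.mk.inj h).2), Finset.mul_sum, Finset.mul_sum]
  congr 1
  · refine Finset.sum_congr rfl fun y _ => ?_
    rw [prod_p_left]
    push_cast
    ring
  · refine Finset.sum_congr rfl fun y _ => ?_
    rw [prod_p_right]
    push_cast
    ring

theorem prod_grad_left (F : V × V' → 𝕜) (u v : V) (u' : V') :
    (prod α β hα hβ G G').grad F (u, u') (v, u') = G.grad (fun y => F (y, u')) u v := by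
  simp [grad, prod]

/-- The product connection tests the second coordinates first, so for u' = v' it would return the
unconstrained value `G.σ u u`. -/
theorem prod_grad_right (F : V × V' → 𝕜) (u : V) {u' v' : V'} (h : u' ≠ v') :
    (prod α β hα hβ G G').grad F (u, u') (u, v') = G'.grad (fun y' => F (u, y')) u' v' := by
  simp [grad, prod, h]

theorem prod_lap (F : V × V' → 𝕜) (u : V) (u' : V') :
    (prod α β hα hβ G G').lap F (u, u') =
      α * G.lap (fun y => F (y, u')) u + β * G'.lap (fun y' => F (u, y')) u' := by
  unfold WeightedGraph.lap
  exact sum_nbr_prod G G' hα hβ (fun q => F q - F (u, u')) u u'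

theorem prod_connLap (F : V × V' → 𝕜) (u : V) (u' : V') :
    (prod α β hα hβ G G').connLap F (u, u') =
      α * G.connLap (fun y => F (y, u')) u + β * G'.connLap (fun y' => F (u, y')) u' := by
  simp only [connLap_eq_sum_grad]
  rw [sum_nbr_prod G G' hα hβ ((prod α β hα hβ G G').grad F (u, u')) u u']
  simp only [prod_grad_left]
  congr 2
  exact Finset.sum_congr rfl fun y hy => by
    rw [prod_grad_right _ _ _ _ _ _ (G'.mem_nbr.1 hy).ne]

theorem prod_Gam (F E : V × V' → 𝕜) (u : V) (u' : V') :
    (prod α β hα hβ G G').Gam F E (u, u') =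
      α * G.Gam (fun y => F (y, u')) (fun y => E (y, u')) u +
        β * G'.Gam (fun y' => F (u, y')) (fun y' => E (u, y')) u' := by
  simp only [Gam_eq_sum_grad]
  rw [sum_nbr_prod G G' hα hβ (fun q => (prod α β hα hβ G G').grad F (u, u') q *
    star ((prod α β hα hβ G G').grad E (u, u') q)) u u']
  simp only [prod_grad_left]
  rw [mul_add, mul_left_comm, mul_left_comm (1 / 2 : 𝕜)]
  congr 3
  exact Finset.sum_congr rfl fun y hy => by
    rw [prod_grad_right _ _ _ _ _ _ (G'.mem_nbr.1 hy).ne,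
      prod_grad_right _ _ _ _ _ _ (G'.mem_nbr.1 hy).ne]

theorem star_ofReal (a : ℝ) : star (a : 𝕜) = a := RCLike.conj_ofReal a

theorem lap_linear (a b : 𝕜) (f g : V → 𝕜) (x : V) :
    G.lap (fun y => a * f y + b * g y) x = a * G.lap f x + b * G.lap g x := by
  unfold WeightedGraph.lap
  rw [Finset.mul_sum, Finset.mul_sum, ← Finset.sum_add_distrib]
  exact Finset.sum_congr rfl fun y _ => by ring

theorem Gam_linear_left (a b : 𝕜) (f g h : V → 𝕜) (x : V) :
    G.Gam (fun y => a * f y + b * g y) h x = a * G.Gam f h x + b * G.Gam g h x := by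
  simp only [Gam_eq_sum_grad, Finset.mul_sum]
  rw [← Finset.sum_add_distrib]
  exact Finset.sum_congr rfl fun y _ => by simp only [grad]; ring

theorem Gam_linear_right (a b : ℝ) (f g h : V → 𝕜) (x : V) :
    G.Gam h (fun y => a * f y + b * g y) x = a * G.Gam h f x + b * G.Gam h g x := by
  rw [← G.star_Gam, Gam_linear_left, star_add, star_mul', star_mul', G.star_Gam, G.star_Gam,
    star_ofReal, star_ofReal]

/-- The mixed terms in the product formula for `Γ₂`. -/
theorem mixed_terms_eq (F : V → V' → 𝕜) (u : V) (u' : V') :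
    G.lap (fun y => G'.Gam (F y) (F y) u') u
        - G'.Gam (F u) (fun y' => G.connLap (fun y => F y y') u) u'
        - G'.Gam (fun y' => G.connLap (fun y => F y y') u) (F u) u' =
      ∑ y ∈ G.nbr u, (G.p u y : 𝕜) *
        G'.Gam (fun y' => G.grad (fun z => F z y') u y) (fun y' => G.grad (fun z => F z y') u y)
          u' := by
  have hl : ∀ g : V' → 𝕜, G'.Gam (fun y' => G.connLap (fun y => F y y') u) g u' =
      ∑ y ∈ G.nbr u, (G.p u y : 𝕜) * G'.Gam (fun y' => G.grad (fun z => F z y') u y) g u' := by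
    intro g
    have hg : ∀ v', G'.grad (fun y' => G.connLap (fun y => F y y') u) u' v' =
        ∑ y ∈ G.nbr u, (G.p u y : 𝕜) * G'.grad (fun y' => G.grad (fun z => F z y') u y) u' v' := by
      intro v'
      simp only [grad, connLap, Finset.mul_sum]
      rw [← Finset.sum_sub_distrib]
      exact Finset.sum_congr rfl fun y _ => by ring
    simp only [Gam_eq_sum_grad, hg, Finset.mul_sum, Finset.sum_mul]
    rw [Finset.sum_comm]
    exact Finset.sum_congr rfl fun y _ => Finset.sum_congr rfl fun y' _ => by ring
  have hr : G'.Gam (F u) (fun y' => G.connLap (fun y => F y y') u) u' =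
      ∑ y ∈ G.nbr u, (G.p u y : 𝕜) * G'.Gam (F u) (fun y' => G.grad (fun z => F z y') u y) u' := by
    rw [← G'.star_Gam, hl, star_sum]
    exact Finset.sum_congr rfl fun y _ => by rw [star_mul', G'.star_Gam, star_ofReal]
  rw [hl, hr, WeightedGraph.lap, ← Finset.sum_sub_distrib, ← Finset.sum_sub_distrib]
  refine Finset.sum_congr rfl fun y _ => ?_
  rw [← mul_sub, ← mul_sub]
  congr 1
  -- With a, b the G'-differences of `F y` and `F u`, the edgewise claim (for the fixed σ = σ_{uy})
  -- is |a|² - |b|² - 2 Re((σa - b) b̄) = |σa - b|², which uses |σ| = 1.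
  have hσ : (G.σ u y : 𝕜) * star (G.σ u y : 𝕜) = 1 := Unitary.coe_mul_star_self _
  have hg : ∀ v', G'.grad (fun y' => G.grad (fun z => F z y') u y) u' v' =
      (G.σ u y : 𝕜) * G'.grad (F y) u' v' - G'.grad (F u) u' v' := fun v' => by
    simp only [grad]; ring
  simp only [Gam_eq_sum_grad, hg]
  rw [← mul_sub, ← mul_sub, ← mul_sub, ← Finset.sum_sub_distrib, ← Finset.sum_sub_distrib,
    ← Finset.sum_sub_distrib]
  congr 1
  refine Finset.sum_congr rfl fun y' _ => ?_
  simp only [star_sub, star_mul']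
  linear_combination -((G'.p u' y' : 𝕜) * G'.grad (F y) u' y' * star (G'.grad (F y) u' y')) * hσ

/-- Expanding by bilinearity, the α² and β² parts are the Γ₂ of the factors, and the αβ part
consists of the two expressions rewritten as sums of Γ by `mixed_terms_eq`. -/
theorem prod_Gam₂ (F : V × V' → 𝕜) (u : V) (u' : V') :
    (prod α β hα hβ G G').Gam₂ F F (u, u') =
      α ^ 2 * G.Gam₂ (fun y => F (y, u')) (fun y => F (y, u')) u +
        β ^ 2 * G'.Gam₂ (fun y' => F (u, y')) (fun y' => F (u, y')) u' +
        α * β / 2 * (∑ y ∈ G.nbr u, (G.p u y : 𝕜) *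
          G'.Gam (fun y' => G.grad (fun z => F (z, y')) u y)
            (fun y' => G.grad (fun z => F (z, y')) u y) u') +
        α * β / 2 * (∑ y' ∈ G'.nbr u', (G'.p u' y' : 𝕜) *
          G.Gam (fun y => G'.grad (fun z => F (y, z)) u' y')
            (fun y => G'.grad (fun z => F (y, z)) u' y') u) := by
  have h1 := mixed_terms_eq G G' (fun y y' => F (y, y')) u u'
  have h2 := mixed_terms_eq G' G (fun y' y => F (y, y')) u' u
  simp only [Gam₂]
  rw [prod_lap, prod_Gam, prod_Gam, ← h1, ← h2]
  simp only [prod_Gam, prod_connLap, lap_linear, Gam_linear_left, Gam_linear_right]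
  ring

theorem re_prod_Gam₂ (F : V × V' → 𝕜) (u : V) (u' : V') :
    RCLike.re ((prod α β hα hβ G G').Gam₂ F F (u, u')) =
      α ^ 2 * RCLike.re (G.Gam₂ (fun y => F (y, u')) (fun y => F (y, u')) u) +
        β ^ 2 * RCLike.re (G'.Gam₂ (fun y' => F (u, y')) (fun y' => F (u, y')) u') +
        α * β / 2 * (∑ y ∈ G.nbr u, G.p u y *
          RCLike.re (G'.Gam (fun y' => G.grad (fun z => F (z, y')) u y)
            (fun y' => G.grad (fun z => F (z, y')) u y) u')) +
        α * β / 2 * (∑ y' ∈ G'.nbr u', G'.p u' y' *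
          RCLike.re (G.Gam (fun y => G'.grad (fun z => F (y, z)) u' y')
            (fun y => G'.grad (fun z => F (y, z)) u' y') u)) := by
  have e1 : (α : 𝕜) ^ 2 = ((α ^ 2 : ℝ) : 𝕜) := by push_cast; rfl
  have e2 : (β : 𝕜) ^ 2 = ((β ^ 2 : ℝ) : 𝕜) := by push_cast; rfl
  have e3 : (α : 𝕜) * β / 2 = ((α * β / 2 : ℝ) : 𝕜) := by push_cast; rfl
  rw [prod_Gam₂, e1, e2, e3]
  simp only [map_add, RCLike.re_ofReal_mul, map_sum]

theorem re_prod_Gam (F : V × V' → 𝕜) (u : V) (u' : V') :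
    RCLike.re ((prod α β hα hβ G G').Gam F F (u, u')) =
      α * RCLike.re (G.Gam (fun y => F (y, u')) (fun y => F (y, u')) u) +
        β * RCLike.re (G'.Gam (fun y' => F (u, y')) (fun y' => F (u, y')) u') := by
  rw [prod_Gam, map_add, RCLike.re_ofReal_mul, RCLike.re_ofReal_mul]

theorem le_re_prod_Gam₂ (F : V × V' → 𝕜) (u : V) (u' : V') :
    α ^ 2 * RCLike.re (G.Gam₂ (fun y => F (y, u')) (fun y => F (y, u')) u) +
        β ^ 2 * RCLike.re (G'.Gam₂ (fun y' => F (u, y')) (fun y' => F (u, y')) u') ≤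
      RCLike.re ((prod α β hα hβ G G').Gam₂ F F (u, u')) := by
  rw [re_prod_Gam₂, add_assoc]
  have := mul_pos hα hβ
  refine le_add_of_nonneg_right (add_nonneg ?_ ?_)
  · exact mul_nonneg (by positivity) (Finset.sum_nonneg fun y _ =>
      mul_nonneg (G.p_nonneg _ _) (G'.re_Gam_self_nonneg _ _))
  · exact mul_nonneg (by positivity) (Finset.sum_nonneg fun y _ =>
      mul_nonneg (G'.p_nonneg _ _) (G.re_Gam_self_nonneg _ _))

/-- Functions on the factors which agree at the base point extend to the product in such a way that
the mixed terms in `Γ₂` vanish. -/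
theorem exists_extension {u : V} {u' : V'} (f : V → 𝕜) (f' : V' → 𝕜) (h : f u = f' u') :
    ∃ F : V × V' → 𝕜, (∀ y, F (y, u') = f y) ∧ (∀ y', F (u, y') = f' y') ∧
      RCLike.re ((prod α β hα hβ G G').Gam₂ F F (u, u')) =
        α ^ 2 * RCLike.re (G.Gam₂ f f u) + β ^ 2 * RCLike.re (G'.Gam₂ f' f' u') := by
  classical
  -- Off the two fibres the value is obtained by solving "mixed difference = 0" for F(y, y'), where
  -- `star` inverts σ. The fibre prescriptions are compatible at (u, u') by `h`.
  set F : V × V' → 𝕜 := fun q => if q.1 = u then f' q.2 else if q.2 = u' then f q.1 else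
    star (G.σ u q.1 : 𝕜) * (star (G'.σ u' q.2 : 𝕜) * G.grad f u q.1 + f' q.2) with hF
  have hl : ∀ y, F (y, u') = f y := fun y => by
    by_cases hy : y = u
    · subst hy; simp [hF, h]
    · simp [hF, hy]
  have hr : ∀ y', F (u, y') = f' y' := fun y' => by simp [hF]
  have hm : ∀ y ∈ G.nbr u, ∀ y' ∈ G'.nbr u',
      G'.grad (fun y' => G.grad (fun z => F (z, y')) u y) u' y' = 0 := by
    intro y hy y' hy'
    have h1 : y ≠ u := (G.mem_nbr.1 hy).ne'
    have h2 : y' ≠ u' := (G'.mem_nbr.1 hy').ne'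
    have hσ : (G.σ u y : 𝕜) * star (G.σ u y : 𝕜) = 1 := Unitary.coe_mul_star_self _
    have hσ' : (G'.σ u' y' : 𝕜) * star (G'.σ u' y' : 𝕜) = 1 := Unitary.coe_mul_star_self _
    have e : F (y, y') =
        star (G.σ u y : 𝕜) * (star (G'.σ u' y' : 𝕜) * G.grad f u y + f' y') := by
      simp [hF, h1, h2]
    simp only [grad] at e ⊢
    rw [e, hl, hr, hr, ← h]
    linear_combination ((G'.σ u' y' : 𝕜) * (star (G'.σ u' y' : 𝕜) *
      ((G.σ u y : 𝕜) * f y - f u) + f' y')) * hσ + ((G.σ u y : 𝕜) * f y - f u) * hσ'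
  -- Differences in the two directions commute, so the other mixed term vanishes too.
  have hm' : ∀ y' ∈ G'.nbr u', ∀ y ∈ G.nbr u,
      G.grad (fun y => G'.grad (fun z => F (y, z)) u' y') u y = 0 := by
    intro y' hy' y hy
    rw [← hm y hy y' hy']
    simp only [grad]
    ring
  refine ⟨F, hl, hr, ?_⟩
  rw [re_prod_Gam₂, Finset.sum_eq_zero, Finset.sum_eq_zero, mul_zero, add_zero, add_zero]
  · simp only [hl, hr]
  · intro y' hy'
    rw [re_Gam_self, Finset.sum_eq_zero, mul_zero, mul_zero]
    intro y hy
    rw [hm' y' hy' y hy]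
    simp
  · intro y hy
    rw [re_Gam_self, Finset.sum_eq_zero, mul_zero, mul_zero]
    intro y' hy'
    rw [hm y hy y' hy']
    simp

end ConnectionGraph

/-! ### Parallel sections from local balancedness -/

namespace ConnectionGraph

variable {𝕜 : Type*} [RCLike 𝕜] {V V' : Type*} (G : ConnectionGraph 𝕜 V)

/-- An edge with an endpoint at distance 1 cannot lie inside the 2-sphere, so it survives in the
incomplete ball. -/
theorem incTwoBall_adj {x y z : V} (hy : G.graph.Adj x y) (hz : G.graph.Adj y z) :
    (G.incTwoBall x).Adj y z := by
  have h1 : G.graph.edist x y = 1 := SimpleGraph.edist_eq_one_iff_adj.2 hy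
  have h2 : G.graph.edist y z = 1 := SimpleGraph.edist_eq_one_iff_adj.2 hz
  have h3 : G.graph.edist x z ≤ 2 := by
    refine (SimpleGraph.edist_triangle (v := y)).trans ?_
    rw [h1, h2]
    norm_num
  refine ⟨hz, ?_, h3, fun h => ?_⟩
  · rw [h1]; norm_num
  · rw [h1] at h
    exact absurd h.1 (by norm_num)

theorem σ_mul_σ {x y : V} (h : G.graph.Adj x y) : G.σ x y * G.σ y x = 1 := by
  rw [G.σ_inv x y h, inv_mul_cancel]

variable {G}

theorem LocallyBalanced.triangle {x y z : V} (hb : G.LocallyBalanced x) (hy : G.graph.Adj x y)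
    (hz : G.graph.Adj x z) (hyz : G.graph.Adj y z) : G.σ y z * G.σ z x = G.σ y x := by
  have := hb x (.cons (G.incTwoBall_adj hy hy.symm).symm (.cons (G.incTwoBall_adj hy hyz)
    (.cons (G.incTwoBall_adj hz hz.symm) .nil))) (by
      simp [SimpleGraph.Walk.cons_isCycle_iff, hy.ne, hy.ne', hz.ne, hz.ne', hyz.ne])
  simp only [signature, SimpleGraph.Walk.darts_cons, SimpleGraph.Walk.darts_nil, List.map_cons,
    List.map_nil, List.prod_cons, List.prod_nil, mul_one] at this
  rw [G.σ_inv x y hy] at this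
  exact (inv_mul_eq_one.1 this).symm

/-- Transport from x to v does not depend on the intermediate neighbour: for y ≠ z the walk x, y, v,
z, x is a 4-cycle, where v ≠ x is needed. -/
theorem LocallyBalanced.square {x y z v : V} (hb : G.LocallyBalanced x) (hy : G.graph.Adj x y)
    (hz : G.graph.Adj x z) (hyv : G.graph.Adj y v) (hzv : G.graph.Adj z v) (hv : v ≠ x) :
    G.σ v y * G.σ y x = G.σ v z * G.σ z x := by
  by_cases hyz : y = z
  · rw [hyz]
  have := hb x (.cons (G.incTwoBall_adj hy hy.symm).symm (.cons (G.incTwoBall_adj hy hyv)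
    (.cons (G.incTwoBall_adj hz hzv).symm (.cons (G.incTwoBall_adj hz hz.symm) .nil)))) (by
      simp [SimpleGraph.Walk.cons_isCycle_iff, hy.ne, hy.ne', hz.ne, hz.ne', hyv.ne,
        hzv.ne', hv, hv.symm, hyz])
  simp only [signature, SimpleGraph.Walk.darts_cons, SimpleGraph.Walk.darts_nil, List.map_cons,
    List.map_nil, List.prod_cons, List.prod_nil, mul_one] at this
  rw [G.σ_inv x y hy, G.σ_inv y v hyv] at this
  rw [← inv_mul_eq_one, mul_inv_rev, mul_assoc]
  exact this

/-- A balanced local connection structure admits a section which is parallel along all edges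
meeting the closed 1-ball. -/
theorem LocallyBalanced.exists_parallel {x : V} (hb : G.LocallyBalanced x) :
    ∃ s : V → 𝕜, s x = 1 ∧ (∀ v ∈ G.nbr x, G.grad s x v = 0) ∧
      ∀ u ∈ G.nbr x, ∀ v ∈ G.nbr u, G.grad s u v = 0 := by
  classical
  simp only [WeightedGraph.mem_nbr]
  -- The value at v must be the transport from x along any path of length at most 2. Triangles
  -- reconcile length 1 with length 2, and squares reconcile two paths of length 2.
  have hs : ∀ v, ∃ c : unitary 𝕜, (v = x → c = 1) ∧ (G.graph.Adj x v → c = G.σ v x) ∧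
      ∀ u, G.graph.Adj x u → G.graph.Adj u v → c = G.σ v u * G.σ u x := by
    intro v
    by_cases hv : v = x
    · subst hv
      exact ⟨1, fun _ => rfl, fun h => absurd rfl h.ne, fun u hu _ => (G.σ_mul_σ hu).symm⟩
    by_cases hvx : G.graph.Adj x v
    · exact ⟨G.σ v x, fun h => absurd h hv, fun _ => rfl,
        fun u hu huv => (hb.triangle hvx hu huv.symm).symm⟩
    by_cases hvu : ∃ u, G.graph.Adj x u ∧ G.graph.Adj u v
    · obtain ⟨u, hu, huv⟩ := hvu
      exact ⟨G.σ v u * G.σ u x, fun h => absurd h hv, fun h => absurd h hvx,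
        fun w hw hwv => hb.square hu hw huv hwv hv⟩
    · exact ⟨1, fun _ => rfl, fun h => absurd h hvx, fun u hu huv => absurd ⟨u, hu, huv⟩ hvu⟩
  choose c hc0 hc1 hc2 using hs
  refine ⟨fun v => (c v : 𝕜), by simp [hc0 x rfl], fun v hv => ?_, fun u hu v hv => ?_⟩
  · have : G.σ x v * c v = c x := by rw [hc1 v hv, hc0 x rfl, G.σ_mul_σ hv]
    rw [grad, ← this]
    simp
  · have : G.σ u v * c v = c u := by
      rw [hc2 v u hu hv, hc1 u hu, ← mul_assoc, G.σ_mul_σ hv, one_mul]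
    rw [grad, ← this]
    simp

/-- At a vertex with balanced local connection structure, the value of a function at this vertex
can be prescribed without changing the curvature quantities. -/
theorem LocallyBalanced.exists_translate {x : V} (hb : G.LocallyBalanced x) (f : V → 𝕜) (a : 𝕜) :
    ∃ g : V → 𝕜, g x = a ∧ G.connLap g x = G.connLap f x ∧ G.Gam g g x = G.Gam f f x ∧
      G.Gam₂ g g x = G.Gam₂ f f x := by
  obtain ⟨s, hs0, hs1, hs2⟩ := hb.exists_parallel
  -- Adding (a - f x)·s corrects the base value, since s(x) = 1, and leaves covariant differences
  -- unchanged wherever s is parallel.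
  have hg : ∀ u v, G.grad s u v = 0 →
      G.grad (fun y => f y + (a - f x) * s y) u v = G.grad f u v := by
    intro u v h
    simp only [grad] at h ⊢
    linear_combination (a - f x) * h
  have h1 : ∀ v ∈ G.nbr x, G.grad (fun y => f y + (a - f x) * s y) x v = G.grad f x v :=
    fun v hv => hg _ _ (hs1 v hv)
  have h2 : ∀ u ∈ G.nbr x, ∀ v ∈ G.nbr u,
      G.grad (fun y => f y + (a - f x) * s y) u v = G.grad f u v :=
    fun u hu v hv => hg _ _ (hs2 u hu v hv)
  exact ⟨_, by simp [hs0], G.connLap_congr h1, G.Gam_congr h1 h1, G.Gam₂_congr h1 h2⟩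

end ConnectionGraph

/-! ### Comparison of the product curvature with the factors -/

namespace ConnectionGraph

variable {𝕜 : Type*} [RCLike 𝕜] {V V' : Type*} (G : ConnectionGraph 𝕜 V)
  (G' : ConnectionGraph 𝕜 V') {α β : ℝ} (hα : 0 < α) (hβ : 0 < β)

theorem connLap_const_mul (c : 𝕜) (f : V → 𝕜) (x : V) :
    G.connLap (fun y => c * f y) x = c * G.connLap f x := by
  unfold connLap
  rw [Finset.mul_sum]
  exact Finset.sum_congr rfl fun y _ => by ring

theorem Gam_const_mul (c : 𝕜) (f g : V → 𝕜) (x : V) :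
    G.Gam (fun y => c * f y) (fun y => c * g y) x = c * star c * G.Gam f g x := by
  simp only [Gam_eq_sum_grad, Finset.mul_sum]
  refine Finset.sum_congr rfl fun y _ => ?_
  simp only [grad, star_sub, star_mul']
  ring

theorem Gam₂_const_mul (c : 𝕜) (f : V → 𝕜) (x : V) :
    G.Gam₂ (fun y => c * f y) (fun y => c * f y) x = c * star c * G.Gam₂ f f x := by
  have hL : G.connLap (fun y => c * f y) = fun y => c * G.connLap f y :=
    funext fun y => G.connLap_const_mul c f y
  have hG : G.Gam (fun y => c * f y) (fun y => c * f y) = fun y => c * star c * G.Gam f f y :=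
    funext fun y => G.Gam_const_mul c f f y
  have hlap := G.lap_linear (c * star c) 0 (G.Gam f f) 0 x
  simp only [zero_mul, add_zero] at hlap
  unfold Gam₂
  rw [hL, hG, Gam_const_mul, Gam_const_mul, hlap]
  ring

theorem forms_zero (x : V) : G.connLap 0 x = 0 ∧ G.Gam 0 0 x = 0 ∧ G.Gam₂ 0 0 x = 0 := by
  have hL : G.connLap 0 = 0 := funext fun w => by simp [connLap]
  have hG : G.Gam 0 0 = 0 := funext fun w => by simp [Gam_eq_sum_grad, grad]
  exact ⟨by rw [hL]; rfl, by rw [hG]; rfl, by simp [Gam₂, hL, hG, WeightedGraph.lap]⟩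

theorem re_mul_star_mul (c z : 𝕜) : RCLike.re (c * star c * z) = ‖c‖ ^ 2 * RCLike.re z := by
  rw [RCLike.star_def, RCLike.mul_conj, ← RCLike.ofReal_pow, RCLike.re_ofReal_mul]

/-- A failing curvature-dimension inequality fails for a function with vanishing Laplacian term or
for one with normalized Laplacian. -/
theorem exists_of_curvature_lt {x : V} (hx : ∃ y, G.graph.Adj x y) (hα : 0 < α) {N : ℝ≥0∞}
    {k : ℝ} (hk : α * G.curvature x N < k) :
    (∃ f : V → 𝕜, α ^ 2 * RCLike.re (G.Gam₂ f f x) < k * (α * RCLike.re (G.Gam f f x))) ∨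
      (N ≠ ∞ ∧ ∃ f : V → 𝕜, α * G.connLap f x = (N.toReal : 𝕜) ∧
        α ^ 2 * RCLike.re (G.Gam₂ f f x) < N.toReal + k * (α * RCLike.re (G.Gam f f x))) := by
  have hα' : (α : 𝕜) ≠ 0 := by exact_mod_cast hα.ne'
  have hn : ¬ G.CD x (k / α) N := by
    rw [G.CD_iff_le_curvature hx, not_le, lt_div_iff₀ hα]
    linarith
  simp only [CD, not_forall, ge_iff_le, not_le] at hn
  obtain ⟨f, hf⟩ := hn
  have hf' : α ^ 2 * RCLike.re (G.Gam₂ f f x) <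
      N⁻¹.toReal * (α ^ 2 * ‖G.connLap f x‖ ^ 2) + k * (α * RCLike.re (G.Gam f f x)) := by
    have := mul_lt_mul_of_pos_left hf (pow_pos hα 2)
    refine this.trans_eq ?_
    field_simp
  -- If the dimension term vanishes, f itself serves; otherwise N is finite and f can be rescaled.
  by_cases h0 : N⁻¹.toReal * (α ^ 2 * ‖G.connLap f x‖ ^ 2) = 0
  · left
    exact ⟨f, by rwa [h0, zero_add] at hf'⟩
  · right
    have hN : N⁻¹.toReal ≠ 0 := left_ne_zero_of_mul h0
    have hN1 : N ≠ ∞ := by rintro rfl; simp at hN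
    rw [ENNReal.toReal_inv] at hN hf'
    have hN2 : N.toReal ≠ 0 := fun h => hN (by rw [h, inv_zero])
    have hL : G.connLap f x ≠ 0 := by
      intro h
      rw [h] at h0
      simp at h0
    have hL' : ‖G.connLap f x‖ ≠ 0 := norm_ne_zero_iff.2 hL
    -- This scalar makes αΔ^σ(cf)(x) = N, so the dimension term α²|Δ^σ(cf)|²/N becomes N²/N = N.
    set c : 𝕜 := (N.toReal : 𝕜) / (α * G.connLap f x) with hc
    have hcn : ‖c‖ ^ 2 = N.toReal ^ 2 / (α ^ 2 * ‖G.connLap f x‖ ^ 2) := by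
      rw [hc, norm_div, norm_mul, RCLike.norm_ofReal, RCLike.norm_ofReal, div_pow, mul_pow,
        sq_abs, sq_abs]
    have hcpos : 0 < ‖c‖ ^ 2 := by
      rw [hcn]
      have := hα.ne'
      positivity
    refine ⟨hN1, fun y => c * f y, ?_, ?_⟩
    · rw [connLap_const_mul, hc]
      field_simp
    · rw [Gam₂_const_mul, Gam_const_mul, re_mul_star_mul, re_mul_star_mul]
      have h1 := mul_lt_mul_of_pos_left hf' hcpos
      have h2 : ‖c‖ ^ 2 * (N.toReal⁻¹ * (α ^ 2 * ‖G.connLap f x‖ ^ 2)) = N.toReal := by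
        rw [hcn]
        have := hα.ne'
        field_simp
      linarith

/-- Cauchy-Schwarz in Engel form; if N or N' is ∞ the left side is 0. Positivity matters because
`0⁻¹.toReal` is 0. -/
theorem toReal_inv_add_mul_norm_sq_le {N N' : ℝ≥0∞} (hN : 0 < N) (hN' : 0 < N') (a b : 𝕜) :
    (N + N')⁻¹.toReal * ‖a + b‖ ^ 2 ≤ N⁻¹.toReal * ‖a‖ ^ 2 + N'⁻¹.toReal * ‖b‖ ^ 2 := by
  have hr : 0 ≤ N⁻¹.toReal * ‖a‖ ^ 2 + N'⁻¹.toReal * ‖b‖ ^ 2 :=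
    add_nonneg (mul_nonneg ENNReal.toReal_nonneg (sq_nonneg _))
      (mul_nonneg ENNReal.toReal_nonneg (sq_nonneg _))
  by_cases h1 : N = ∞
  · subst h1
    simpa using hr
  by_cases h2 : N' = ∞
  · subst h2
    simpa using hr
  have hn : 0 < N.toReal := ENNReal.toReal_pos hN.ne' h1
  have hn' : 0 < N'.toReal := ENNReal.toReal_pos hN'.ne' h2
  rw [ENNReal.toReal_inv, ENNReal.toReal_inv, ENNReal.toReal_inv, ENNReal.toReal_add h1 h2]
  generalize N.toReal = n at *
  generalize N'.toReal = m at *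
  have h3 : ‖a + b‖ ^ 2 ≤ (‖a‖ + ‖b‖) ^ 2 := pow_le_pow_left₀ (norm_nonneg _) (norm_add_le a b) 2
  refine (mul_le_mul_of_nonneg_left h3 (by positivity)).trans ?_
  rw [← sub_nonneg]
  have : n⁻¹ * ‖a‖ ^ 2 + m⁻¹ * ‖b‖ ^ 2 - (n + m)⁻¹ * (‖a‖ + ‖b‖) ^ 2 =
      (m * ‖a‖ - n * ‖b‖) ^ 2 / (n * m * (n + m)) := by
    field_simp
    ring
  rw [this]
  positivity

variable {G G'}

/-- The mixed terms of Γ₂ are dropped and the two dimension terms are merged by Cauchy-Schwarz. -/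
theorem CD.prod {x : V} {x' : V'} {K k k' : ℝ} {N N' : ℝ≥0∞} (hN : 0 < N) (hN' : 0 < N')
    (h : G.CD x k N) (h' : G'.CD x' k' N') (hk : K ≤ α * k) (hk' : K ≤ β * k') :
    (prod α β hα hβ G G').CD (x, x') K (N + N') := fun F => by
  have h1 := mul_le_mul_of_nonneg_left (h fun y => F (y, x')) (sq_nonneg α)
  have h2 := mul_le_mul_of_nonneg_left (h' fun y' => F (x, y')) (sq_nonneg β)
  have h3 := le_re_prod_Gam₂ G G' hα hβ F x x'
  rw [re_prod_Gam, prod_connLap]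
  have h4 := toReal_inv_add_mul_norm_sq_le hN hN' (α * G.connLap (fun y => F (y, x')) x)
    (β * G'.connLap (fun y' => F (x, y')) x')
  rw [norm_mul, norm_mul, RCLike.norm_ofReal, RCLike.norm_ofReal, mul_pow, mul_pow, sq_abs,
    sq_abs] at h4
  have h5 := mul_le_mul_of_nonneg_right hk
    (mul_nonneg hα.le (G.re_Gam_self_nonneg (fun y => F (y, x')) x))
  have h6 := mul_le_mul_of_nonneg_right hk'
    (mul_nonneg hβ.le (G'.re_Gam_self_nonneg (fun y' => F (x, y')) x'))
  linarith

/-- If one of the two local connection structures is balanced, the curvature-dimension inequality of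
the product can be tested on pairs of functions on the factors. -/
theorem CD.of_prod {x : V} {x' : V'} {K : ℝ} {N : ℝ≥0∞}
    (hbal : G.LocallyBalanced x ∨ G'.LocallyBalanced x')
    (h : (ConnectionGraph.prod α β hα hβ G G').CD (x, x') K N) (f : V → 𝕜) (f' : V' → 𝕜) :
    N⁻¹.toReal * ‖α * G.connLap f x + β * G'.connLap f' x'‖ ^ 2 +
        K * (α * RCLike.re (G.Gam f f x) + β * RCLike.re (G'.Gam f' f' x')) ≤
      α ^ 2 * RCLike.re (G.Gam₂ f f x) + β ^ 2 * RCLike.re (G'.Gam₂ f' f' x') := by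
  have key : ∀ (f : V → 𝕜) (f' : V' → 𝕜), f x = f' x' →
      N⁻¹.toReal * ‖α * G.connLap f x + β * G'.connLap f' x'‖ ^ 2 +
        K * (α * RCLike.re (G.Gam f f x) + β * RCLike.re (G'.Gam f' f' x')) ≤
      α ^ 2 * RCLike.re (G.Gam₂ f f x) + β ^ 2 * RCLike.re (G'.Gam₂ f' f' x') := by
    intro f f' hff
    obtain ⟨F, hl, hr, hF⟩ := exists_extension G G' hα hβ f f' hff
    have := h F
    rw [hF, re_prod_Gam, prod_connLap] at this
    simpa only [hl, hr] using this
  rcases hbal with hb | hb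
  · obtain ⟨g, h0, h1, h2, h3⟩ := hb.exists_translate f (f' x')
    rw [← h1, ← h2, ← h3]
    exact key g f' h0
  · obtain ⟨g, h0, h1, h2, h3⟩ := hb.exists_translate f' (f x)
    rw [← h1, ← h2, ← h3]
    exact key f g h0.symm

theorem min_le_curvature_prod {x : V} {x' : V'} (hx : ∃ y, G.graph.Adj x y)
    (hx' : ∃ y', G'.graph.Adj x' y')
    (hxx : ∃ q, (ConnectionGraph.prod α β hα hβ G G').graph.Adj (x, x') q) {N N' : ℝ≥0∞}
    (hN : 0 < N) (hN' : 0 < N') :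
    min (α * G.curvature x N) (β * G'.curvature x' N') ≤
      (ConnectionGraph.prod α β hα hβ G G').curvature (x, x') (N + N') :=
  (CD_iff_le_curvature _ hxx).1 (CD.prod hα hβ hN hN' (G.isGreatest_curvature hx N).1
    (G'.isGreatest_curvature hx' N').1 (min_le_left _ _) (min_le_right _ _))

theorem curvature_prod_le_max {x : V} {x' : V'} (hx : ∃ y, G.graph.Adj x y)
    (hx' : ∃ y', G'.graph.Adj x' y')
    (hxx : ∃ q, (ConnectionGraph.prod α β hα hβ G G').graph.Adj (x, x') q)
    (hbal : G.LocallyBalanced x ∨ G'.LocallyBalanced x') {N N' : ℝ≥0∞} (hN : 0 < N) :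
    (ConnectionGraph.prod α β hα hβ G G').curvature (x, x') (N + N') ≤
      max (α * G.curvature x N) (β * G'.curvature x' N') := by
  by_contra! hlt
  obtain ⟨h1, h2⟩ := max_lt_iff.1 hlt
  have key := CD.of_prod hα hβ hbal (isGreatest_curvature _ hxx (N + N')).1
  generalize (ConnectionGraph.prod α β hα hβ G G').curvature (x, x') (N + N') = k at *
  have hnn : ∀ a : 𝕜, 0 ≤ (N + N')⁻¹.toReal * ‖a‖ ^ 2 := fun a =>
    mul_nonneg ENNReal.toReal_nonneg (sq_nonneg _)
  rcases G.exists_of_curvature_lt hx hα h1 with ⟨f, hf⟩ | ⟨hNt, f, hfL, hf⟩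
  -- A violation without dimension term is tested against the zero function on the other factor; the
  -- remaining dimension term is nonnegative and can be dropped.
  · have := key f 0
    obtain ⟨z1, z2, z3⟩ := G'.forms_zero x'
    rw [z1, z2, z3] at this
    have h0 := hnn (α * G.connLap f x + β * 0)
    simp only [map_zero, mul_zero, add_zero] at this h0
    linarith
  rcases G'.exists_of_curvature_lt hx' hβ h2 with ⟨f', hf'⟩ | ⟨hNt', f', hfL', hf'⟩
  · have := key 0 f'
    obtain ⟨z1, z2, z3⟩ := G.forms_zero x
    rw [z1, z2, z3] at this
    have h0 := hnn (α * 0 + β * G'.connLap f' x')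
    simp only [map_zero, mul_zero, zero_add] at this h0
    linarith
  -- Both Laplacians are normalized, so the dimension term is (N + N')²/(N + N') = N + N', the sum
  -- of those in `hf` and `hf'`.
  · have := key f f'
    have hn : 0 < N.toReal := ENNReal.toReal_pos hN.ne' hNt
    have hn' : 0 ≤ N'.toReal := ENNReal.toReal_nonneg
    rw [hfL, hfL', ← RCLike.ofReal_add, RCLike.norm_ofReal, sq_abs, ENNReal.toReal_inv,
      ENNReal.toReal_add hNt hNt', sq, inv_mul_cancel_left₀ (by positivity)] at this
    linarith

end ConnectionGraph

theorem mainTheorem9 {𝕜 : Type*} [RCLike 𝕜] {V V' : Type*}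
    (G : ConnectionGraph 𝕜 V) (G' : ConnectionGraph 𝕜 V')
    (α β : ℝ) (hα : 0 < α) (hβ : 0 < β) (x : V) (x' : V')
    (hx : ∃ y, G.graph.Adj x y) (hx' : ∃ y', G'.graph.Adj x' y')
    (hbal : G.LocallyBalanced x ∨ G'.LocallyBalanced x') :
    (∀ N : ℝ≥0∞, 0 < N →
      IsGreatest {K : ℝ | G.CD x K N} (G.curvature x N) ∧
      IsGreatest {K : ℝ | G'.CD x' K N} (G'.curvature x' N) ∧
      IsGreatest {K : ℝ | (ConnectionGraph.prod α β hα hβ G G').CD (x, x') K N}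
        ((ConnectionGraph.prod α β hα hβ G G').curvature (x, x') N)) ∧
    (∀ N N' : ℝ≥0∞, 0 < N → 0 < N' →
      min (α * G.curvature x N) (β * G'.curvature x' N') ≤
          (ConnectionGraph.prod α β hα hβ G G').curvature (x, x') (N + N') ∧
        (ConnectionGraph.prod α β hα hβ G G').curvature (x, x') (N + N') ≤
          max (α * G.curvature x N) (β * G'.curvature x' N')) ∧
    StarAdmissible (fun N => α * G.curvature x N) ∧
    StarAdmissible (fun N => β * G'.curvature x' N) ∧
    ∀ N : ℝ≥0∞, 0 < N →
      (ConnectionGraph.prod α β hα hβ G G').curvature (x, x') N =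
        starProduct (fun N => α * G.curvature x N) (fun N => β * G'.curvature x' N) N := by
  have hxx : ∃ q, (ConnectionGraph.prod α β hα hβ G G').graph.Adj (x, x') q := by
    obtain ⟨y, hy⟩ := hx
    exact ⟨(y, x'), (ConnectionGraph.prod_adj_iff G G' hα hβ _ _).2 (Or.inl ⟨rfl, hy⟩)⟩
  have h₁ := (G.starAdmissible_curvature hx).const_mul hα
  have h₂ := (G'.starAdmissible_curvature hx').const_mul hβ
  refine ⟨fun N _ => ⟨G.isGreatest_curvature hx N, G'.isGreatest_curvature hx' N,
    ConnectionGraph.isGreatest_curvature _ hxx N⟩, fun N N' hN hN' =>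
    ⟨ConnectionGraph.min_le_curvature_prod hα hβ hx hx' hxx hN hN',
      ConnectionGraph.curvature_prod_le_max hα hβ hx hx' hxx hbal hN⟩, h₁, h₂, fun N hN => ?_⟩
  -- Since the two factor values agree at (t₁, t₂), the min and max bounds collapse to one number.
  obtain ⟨t₁, t₂, ht₁, ht₂, rfl, h⟩ := h₁.exists_decomposition h₂ hN
  rw [h₁.starProduct_eq h₂ ht₁ ht₂ h]
  have hmin := ConnectionGraph.min_le_curvature_prod hα hβ hx hx' hxx ht₁ ht₂
  have hmax := ConnectionGraph.curvature_prod_le_max hα hβ hx hx' hxx hbal (N' := t₂) ht₁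
  rw [← h, min_self] at hmin
  rw [← h, max_self] at hmax
  exact le_antisymm hmax hmin
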